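/- Let $R$ be a commutative ring and let $V_R$ be the category of finitely generated projective $R$-modules. For $s\ge 0$, let $\Gamma^sV_R$ be the $R$-linear category with the same objects as $V_R$, whose morphisms $M\to N$ are the $\mathfrak S_s$-equivariant $R$-linear maps $M^{\otimes s}\to N^{\otimes s}$ (tensor powers over $R$, permuted factors, $M^{\otimes 0}=R$). A homogeneous strict polynomial functor of weight $s$ over $R$ is an $R$-linear functor $F$ from $\Gamma^sV_R$ to $R$-modules; its underlying ordinary functor $V_R\to R\text{-Mod}$ is its composite with $M\mapsto M$, $f\mapsto f^{\otimes s}$. For a functor $F:V_R\to R\text{-Mod}$ and $d\ge 0$, the $d$-th cross effect $\mathrm{Cr}_dF(X_1,\dots,X_d)$ is the set of elements of $F(X_1\oplus\dots\oplus X_d)$ that are sent to zero by $F$ of each of the $d$ canonical projections forgetting one summand $X_i$. The Eilenberg–Mac Lane degree $\deg(F)$ of a nonzero functor $F$ is the least integer $d\ge 0$ such that $\mathrm{Cr}_{d+1}F=0$ (and $\infty$ if there is none); $\deg(0)=-\infty$. The degree of a strict polynomial functor is that of its underlying functor. Let $p$ be a prime. Write $\mathrm{DIG}_p(s)$ for the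 sum of the digits of the $p$-adic expansion of $s$, and $$\mathrm{INT}(p,s)=\{n\in\mathbb N \mid n\equiv s \bmod (p-1),\ \mathrm{DIG}_p(s)\le n\le s\}.$$ **Theorem.** Let $F$ be a nonzero homogeneous strict polynomial functor of weight $s$ over $R$ that is $p$-primary, i.e. for every $M\in V_R$ and $x\in F(M)$ there is $r\in\mathbb N$ with $p^rx=0$. Then: 1. $\deg(F)$ is an element of $\mathrm{INT}(p,s)$. 2. If $\deg(F)<s$, then the integral torsion of $F$ is bounded by $p^r$, i.e. $p^rx=0$ for all $M\in V_R$ and all $x\in F(M)$, where $$r=\left\lceil \frac{\deg(F)+1-\mathrm{DIG}_p(s)}{p-1}\right\rceil .$$ -/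

import Mathlib

open CategoryTheory
open scoped TensorProduct

universe u w

/-- The category `V_R` of finitely generated projective `R`-modules
(a full subcategory of the category of all `R`-modules). -/
abbrev FGProj (R : Type u) [CommRing R] : Type (u + 1) :=
  ObjectProperty.FullSubcategory
    (fun M : ModuleCat.{u} R => Module.Finite R M ∧ Module.Projective R M)

namespace FGProj

variable {R : Type u} [CommRing R]

instance (M : FGProj R) : Module.Finite R M.obj := M.property.1

instance (M : FGProj R) : Module.Projective R M.obj := M.property.2

/-- A finitely generated projective module, as an object of `V_R`. -/
def of (R : Type u) [CommRing R] (M : Type u) [AddCommGroup M] [Module R M]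
    [Module.Finite R M] [Module.Projective R M] : FGProj R :=
  ⟨ModuleCat.of R M, inferInstanceAs (Module.Finite R M),
    inferInstanceAs (Module.Projective R M)⟩

/-- A linear map, as a morphism of `V_R`. -/
def ofHom {M N : FGProj R} (f : M.obj →ₗ[R] N.obj) : M ⟶ N :=
  ObjectProperty.homMk (ModuleCat.ofHom f)

/-- The linear map underlying a morphism of `V_R`. -/
def linearMap {M N : FGProj R} (f : M ⟶ N) : M.obj →ₗ[R] N.obj :=
  f.hom.hom

/-- The finite direct sum `⨁ i, X i` in `V_R`, realized as the module of families. -/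
def directSum {ι : Type} [Finite ι] (X : ι → FGProj R) : FGProj R :=
  haveI : Fintype ι := Fintype.ofFinite ι
  haveI : Module.Projective R (∀ i, (X i).obj) := by
    classical
    exact Module.Projective.of_equiv
      (DirectSum.linearEquivFunOnFintype R ι (fun i => (X i).obj))
  of R (∀ i, (X i).obj)

/-- The canonical projection `⨁ j, X j ⟶ ⨁ j ≠ i, X j` that forgets the `i`-th summand. -/
def forgetSummand {ι : Type} [Finite ι] (X : ι → FGProj R) (i : ι) :
    directSum X ⟶ directSum (fun j : {j : ι // j ≠ i} => X j) :=
  ofHom (M := directSum X) (N := directSum (fun j : {j : ι // j ≠ i} => X j))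
    (LinearMap.pi (fun j : {j : ι // j ≠ i} =>
      LinearMap.proj (R := R) (φ := fun k : ι => (X k).obj) (j : ι)))

end FGProj

section EilenbergMacLaneDegree

variable {R : Type u} [CommRing R]

/-- The value `Cr_d F(X₁, …, X_d)` of the `d`-th cross effect of `F : V_R ⥤ R-Mod`: the direct
summand of `F(X₁ ⊕ ⋯ ⊕ X_d)` that consists of the elements killed by `F` of each of the `d`
projections that forget one summand, i.e. the summand of `F(X₁ ⊕ ⋯ ⊕ X_d)` that does not come
from partial sums. (For `d = 0` this is `F(0)`.) -/
def crossEffect (F : FGProj R ⥤ ModuleCat.{w} R) {d : ℕ} (X : Fin d → FGProj R) :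
    Submodule R (F.obj (FGProj.directSum X)) :=
  ⨅ i : Fin d, LinearMap.ker (F.map (FGProj.forgetSummand X i)).hom

/-- `F` is polynomial of degree less than or equal to `d`: `Cr_{d+1} F = 0`. -/
def IsPolynomialOfDegreeLE (F : FGProj R ⥤ ModuleCat.{w} R) (d : ℕ) : Prop :=
  ∀ X : Fin (d + 1) → FGProj R, crossEffect F X = ⊥

open Classical in
/-- The degree of a functor `F : V_R ⥤ R-Mod` in the sense of Eilenberg and Mac Lane: `-∞` if `F`
is the zero functor; otherwise the least `d` such that `F` is polynomial of degree `≤ d`, and `∞`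
if there is no such `d`. -/
noncomputable def emlDegree (F : FGProj R ⥤ ModuleCat.{w} R) : WithBot ℕ∞ :=
  if ∀ M : FGProj R, Subsingleton (F.obj M) then ⊥
  else ((⨅ (d : ℕ) (_ : IsPolynomialOfDegreeLE F d), (d : ℕ∞) : ℕ∞) : WithBot ℕ∞)

end EilenbergMacLaneDegree

section StrictPolynomialFunctors

variable {R : Type u} [CommRing R]

/-- The `R`-module of `Σ_s`-equivariant `R`-linear maps `M^{⊗ s} → N^{⊗ s}`, where a permutation
`σ` acts on tensor powers by permuting the factors. -/
def equivariantMaps (R : Type u) [CommRing R] (s : ℕ) (M N : Type u) [AddCommGroup M] [Module R M]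
    [AddCommGroup N] [Module R N] :
    Submodule R ((⨂[R] _ : Fin s, M) →ₗ[R] (⨂[R] _ : Fin s, N)) where
  carrier := {f | ∀ (σ : Equiv.Perm (Fin s)) (x : ⨂[R] _ : Fin s, M),
    f (PiTensorProduct.reindex R (fun _ => M) σ x) =
      PiTensorProduct.reindex R (fun _ => N) σ (f x)}
  add_mem' := by
    intro f g hf hg σ x
    simp only [LinearMap.add_apply, hf σ x, hg σ x, map_add]
  zero_mem' := by
    intro σ x
    simp only [LinearMap.zero_apply, map_zero]
  smul_mem' := by
    intro c f hf σ x
    simp only [LinearMap.smul_apply, hf σ x, map_smul]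

/-- The objects of the Schur category `Γ^s V_R`: the finitely generated projective `R`-modules. -/
structure SchurCat (R : Type u) [CommRing R] (s : ℕ) : Type (u + 1) where
  /-- The underlying finitely generated projective module. -/
  module : FGProj R

variable {s : ℕ}

/-- The morphisms of the Schur category from `M` to `N` are the `Σ_s`-equivariant `R`-linear maps
`M^{⊗ s} → N^{⊗ s}`, and they are composed as maps. -/
instance : Category (SchurCat R s) where
  Hom M N := ↥(equivariantMaps R s M.module.obj N.module.obj)
  id _ := ⟨LinearMap.id, fun _ _ => rfl⟩
  comp f g := ⟨g.1 ∘ₗ f.1, fun σ x => by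
    simp only [LinearMap.comp_apply]
    rw [f.2 σ x, g.2 σ (f.1 x)]⟩

instance : Preadditive (SchurCat R s) where
  homGroup M N := inferInstanceAs
    (AddCommGroup ↥(equivariantMaps R s M.module.obj N.module.obj))
  add_comp _ _ _ _ _ g := Subtype.ext (LinearMap.comp_add _ _ g.1)
  comp_add _ _ _ _ _ _ := Subtype.ext (LinearMap.add_comp _ _ _)

instance : Linear R (SchurCat R s) where
  homModule M N := inferInstanceAs
    (Module R ↥(equivariantMaps R s M.module.obj N.module.obj))
  smul_comp _ _ _ r f g := Subtype.ext (LinearMap.comp_smul g.1 r f.1)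
  comp_smul _ _ _ f r g := Subtype.ext (LinearMap.smul_comp r g.1 f.1)

/-- The functor `γ_s : V_R ⥤ Γ^s V_R`, the identity on objects and `f ↦ f^{⊗ s}` on morphisms. -/
def gammaFunctor (R : Type u) [CommRing R] (s : ℕ) : FGProj R ⥤ SchurCat R s where
  obj M := ⟨M⟩
  map f := ⟨PiTensorProduct.map (fun _ => FGProj.linearMap f), fun σ x =>
    PiTensorProduct.map_reindex (fun _ => FGProj.linearMap f) σ x⟩
  map_id _ := Subtype.ext PiTensorProduct.map_id
  map_comp f g := Subtype.ext
    (PiTensorProduct.map_comp (fun _ => FGProj.linearMap g) (fun _ => FGProj.linearMap f))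

/-- A homogeneous strict polynomial functor of weight `s` over `R`, i.e. an object of `P_{s,R}`:
an `R`-linear functor from the Schur category `Γ^s V_R` to `R`-modules. -/
structure StrictPolyFunctor (R : Type u) [CommRing R] (s : ℕ) where
  /-- The functor on the Schur category. -/
  functor : SchurCat R s ⥤ ModuleCat.{w} R
  additive : functor.Additive
  linear : functor.Linear R

namespace StrictPolyFunctor

/-- The underlying ordinary functor `V_R ⥤ R-Mod` of a strict polynomial functor. -/
def underlying (F : StrictPolyFunctor.{u, w} R s) : FGProj R ⥤ ModuleCat.{w} R :=
  gammaFunctor R s ⋙ F.functor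

/-- `F` is nonzero: some value of `F` is nonzero. -/
def IsNonzero (F : StrictPolyFunctor.{u, w} R s) : Prop :=
  ∃ M : FGProj R, Nontrivial (F.underlying.obj M)

/-- `F` is `p`-primary: every element of every value of `F` is killed by a power of `p`. -/
def IsPrimary (p : ℕ) (F : StrictPolyFunctor.{u, w} R s) : Prop :=
  ∀ (M : FGProj R) (x : F.underlying.obj M), ∃ r : ℕ, p ^ r • x = 0

/-- The torsion of `F` is bounded by the integer `n`: `n` kills all values of `F`. -/
def TorsionBoundedBy (n : ℕ) (F : StrictPolyFunctor.{u, w} R s) : Prop :=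
  ∀ (M : FGProj R) (x : F.underlying.obj M), n • x = 0

end StrictPolyFunctor

end StrictPolynomialFunctors

/-- The sum of the digits in the `p`-adic expansion of `s`. -/
def digitSum (p s : ℕ) : ℕ := (Nat.digits p s).sum

/-- The set of all `n` with `n ≡ s` modulo `p - 1` and `digitSum p s ≤ n ≤ s`. -/
def digitInterval (p s : ℕ) : Set ℕ :=
  {n | n ≡ s [MOD (p - 1)] ∧ digitSum p s ≤ n ∧ n ≤ s}

/-!
The `s`-th tensor power of a finite sum of linear maps `f = ∑ i, f i` breaks up according to how
often each `f i` is used: `f^{⊗ s} = ∑ T(f, c)`, where `c` runs over the families of natural numbers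
with sum `s` and `T(f, c)` is the sum of the tensors `f (w 1) ⊗ ⋯ ⊗ f (w s)` over the words `w` of
content `c`. Each `T(f, c)` (`weightTensor`, `weightMap`) is equivariant, so a strict polynomial
functor `F` of weight `s` acts on it (`StrictPolyFunctor.weightAct`). For the projectors of a direct
sum `X₁ ⊕ ⋯ ⊕ Xₙ` onto its summands this is the weight decomposition of `F(X₁ ⊕ ⋯ ⊕ Xₙ)`, and the
cross effect is the part in which all `c i` are positive
(`StrictPolyFunctor.exists_weightProjection_ne_zero`). Hence the degree `d` of `F` is at most `s`.

If `F` has degree at most `d`, then `F` kills `T(f, c)` as soon as more than `d` of the `c i` are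
positive (`StrictPolyFunctor.weightAct_eq_zero_of_isPolynomialOfDegreeLE`), because `T(f, c)` factors
through a cross effect. There are two ways to use this.

* Splitting one index into two, with multiplicities `b` and `c i - b`, multiplies `T(f, c)` by
  `(c i).choose b`. So if `d` is the degree, and `y ≠ 0` is an element of order `p` in a weight
  space with `d` positive multiplicities, then `p` divides all `(c i).choose b` with `0 < b < c i`,
  which makes every `c i` a power of `p`. Thus `s` is a sum of `d` powers of `p`.
* If all `f i` are the identity, then `T(f, c)` is the multinomial coefficient of `c`. So that
  coefficient kills `F` whenever `c` has more than `d` positive parts.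

Legendre's formula says that if `s` is a sum of `n` powers of `p`, then
`n = digitSum p s + (p - 1) * v`, where `v` is the `p`-adic valuation of the multinomial coefficient
of these powers (`card_eq_digitSum_add`). With `n = d` this is the claim on the degree. For the
torsion, write `d = digitSum p s + (p - 1) * v`; the exponent in the theorem is then `v + 1`.
If `d < s`, then `s` is also a sum of `n = digitSum p s + (p - 1) * (v + 1) > d` powers of `p`
(`exists_sum_pow_eq`), and their multinomial coefficient, of valuation `v + 1`, kills `F`.
-/

/-! ### Words and tensors of given content -/

section WeightTensors

variable {ι : Type} [DecidableEq ι] {s : ℕ}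

/-- The content of a word `w` in the alphabet `ι`: the number of occurrences of each letter. -/
def wordContent (w : Fin s → ι) (i : ι) : ℕ := (Finset.univ.filter fun k => w k = i).card

theorem sum_wordContent [Fintype ι] (w : Fin s → ι) : ∑ i, wordContent w i = s := by
  simpa [wordContent] using
    (Finset.card_eq_sum_card_fiberwise (s := Finset.univ) (t := Finset.univ) (f := w)
      (by simp)).symm

theorem wordContent_pos (w : Fin s → ι) (k : Fin s) : 0 < wordContent w (w k) :=
  Finset.card_pos.mpr ⟨k, by simp⟩

theorem exists_eq_of_wordContent_pos (w : Fin s → ι) (i : ι) (h : 0 < wordContent w i) :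
    ∃ k, w k = i := by
  obtain ⟨k, hk⟩ := Finset.card_pos.mp h
  exact ⟨k, by simpa using hk⟩

theorem wordContent_comp_perm (w : Fin s → ι) (σ : Equiv.Perm (Fin s)) :
    wordContent (w ∘ σ) = wordContent w := by
  funext i
  exact Finset.card_equiv σ (by simp)

/-- Obtained by comparing coefficients in the two expansions of `(∑ i, X i) ^ s`. -/
theorem card_wordContent_eq [Fintype ι] (c : ι → ℕ) (hc : ∑ i, c i = s) :
    (Finset.univ.filter fun w : Fin s → ι => wordContent w = c).card =
      Nat.multinomial Finset.univ c := by
  have h1 := Fintype.sum_pow (fun i : ι => (MvPolynomial.X i : MvPolynomial ι ℕ)) s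
  have h2 := Finset.sum_pow_eq_sum_piAntidiag Finset.univ
    (fun i : ι => (MvPolynomial.X i : MvPolynomial ι ℕ)) s
  have hp (k : ι → ℕ) : ∏ i, (MvPolynomial.X i : MvPolynomial ι ℕ) ^ k i =
      MvPolynomial.monomial (Finsupp.equivFunOnFinite.symm k) 1 := by
    rw [MvPolynomial.monomial_eq, Finsupp.prod_fintype _ _ (by simp)]
    simp
  have hw (w : Fin s → ι) : ∏ k, (MvPolynomial.X (w k) : MvPolynomial ι ℕ) =
      ∏ i, (MvPolynomial.X i : MvPolynomial ι ℕ) ^ wordContent w i := by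
    rw [← Finset.prod_fiberwise' Finset.univ w]
    simp [wordContent]
  have h3 := h1.symm.trans h2
  have h4 := congrArg (MvPolynomial.coeff (Finsupp.equivFunOnFinite.symm c)) h3
  simp only [hw, hp, MvPolynomial.coeff_sum, MvPolynomial.coeff_monomial, ← map_natCast
    (MvPolynomial.C : ℕ →+* MvPolynomial ι ℕ), MvPolynomial.coeff_C_mul,
    EmbeddingLike.apply_eq_iff_eq] at h4
  simpa [hc] using h4

variable [Fintype ι] {R : Type u} [CommRing R]
  {M N P : Type u} [AddCommGroup M] [Module R M] [AddCommGroup N] [Module R N]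
  [AddCommGroup P] [Module R P]

/-- The part of `(∑ i, f i)^{⊗ s}` of weight `c`: the sum of the maps `f (w 1) ⊗ ⋯ ⊗ f (w s)` over all
words `w` of content `c`. It is zero unless `c` has sum `s`. -/
def weightTensor (s : ℕ) (f : ι → M →ₗ[R] N) (c : ι → ℕ) :
    (⨂[R] _ : Fin s, M) →ₗ[R] (⨂[R] _ : Fin s, N) :=
  ∑ w : Fin s → ι with wordContent w = c, PiTensorProduct.map (fun k => f (w k))

theorem weightTensor_mem (f : ι → M →ₗ[R] N) (c : ι → ℕ) :
    weightTensor s f c ∈ equivariantMaps R s M N := by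
  intro σ x
  simp only [weightTensor, LinearMap.sum_apply, map_sum]
  refine Finset.sum_equiv (σ.arrowCongr (Equiv.refl ι)).symm ?_ ?_
  · intro w
    have := wordContent_comp_perm w σ
    simp only [Finset.mem_filter, Finset.mem_univ, true_and]
    rw [← this]; rfl
  · intro w _
    rw [← PiTensorProduct.map_reindex]
    simp [Equiv.arrowCongr]

theorem sum_weightTensor (f : ι → M →ₗ[R] N) :
    ∑ c ∈ Finset.piAntidiag Finset.univ s, weightTensor s f c =
      PiTensorProduct.map (fun _ => ∑ i, f i) := by
  unfold weightTensor
  rw [Finset.sum_fiberwise_of_maps_to]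
  · exact ((PiTensorProduct.mapMultilinear R (fun _ : Fin s => M) (fun _ => N)).map_sum
      (fun _ i => f i)).symm
  · intro w _
    simpa using sum_wordContent w

theorem map_comp_weightTensor (g : N →ₗ[R] P) (f : ι → M →ₗ[R] N) (c : ι → ℕ) :
    PiTensorProduct.map (fun _ => g) ∘ₗ weightTensor s f c =
      weightTensor s (fun i => g ∘ₗ f i) c := by
  ext x
  simp [weightTensor, LinearMap.sum_apply, map_sum]

theorem weightTensor_comp_map (f : ι → N →ₗ[R] P) (c : ι → ℕ) (g : M →ₗ[R] N) :
    weightTensor s f c ∘ₗ PiTensorProduct.map (fun _ => g) =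
      weightTensor s (fun i => f i ∘ₗ g) c := by
  ext x
  simp [weightTensor, LinearMap.sum_apply]

theorem weightTensor_congr {f g : ι → M →ₗ[R] N} {c : ι → ℕ}
    (h : ∀ i, 0 < c i → f i = g i) : weightTensor s f c = weightTensor s g c := by
  refine Finset.sum_congr rfl fun w hw => ?_
  simp only [Finset.mem_filter, Finset.mem_univ, true_and] at hw
  subst hw
  congr 1
  funext k
  exact h _ (wordContent_pos w k)

theorem weightTensor_eq_zero {f : ι → M →ₗ[R] N} {c : ι → ℕ} {i : ι}
    (hi : 0 < c i) (hf : f i = 0) : weightTensor s f c = 0 := by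
  refine Finset.sum_eq_zero fun w hw => ?_
  simp only [Finset.mem_filter, Finset.mem_univ, true_and] at hw
  subst hw
  obtain ⟨k, hk⟩ := exists_eq_of_wordContent_pos w i hi
  exact (PiTensorProduct.mapMultilinear R (fun _ : Fin s => M) (fun _ => N)).map_coord_zero
    k (by rw [hk, hf])

theorem weightTensor_const (f : M →ₗ[R] N) (c : ι → ℕ) (hc : ∑ i, c i = s) :
    weightTensor s (fun _ : ι => f) c =
      (Nat.multinomial Finset.univ c : R) • PiTensorProduct.map (fun _ => f) := by
  rw [weightTensor, Finset.sum_const, card_wordContent_eq c hc, Nat.cast_smul_eq_nsmul]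

/-- The content on `Option ι` obtained from `c` by moving `b` of the occurrences of the letter `i` to
the new letter `none`. -/
def splitContent (c : ι → ℕ) (i : ι) (b : ℕ) : Option ι → ℕ
  | none => b
  | some j => if j = i then c i - b else c j

/-- A word of content `splitContent c i b` that becomes `v` when `none` is renamed to `i` is given by
the `b` occurrences of `i` in `v` that are to be replaced by `none`. -/
theorem card_wordContent_split (c : ι → ℕ) (i : ι) (b : ℕ) (hb : b ≤ c i) (v : Fin s → ι) :
    (Finset.univ.filter fun w : Fin s → Option ι =>
      wordContent w = splitContent c i b ∧ (fun k => (w k).getD i) = v).card =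
      if wordContent v = c then (c i).choose b else 0 := by
  -- the content of `v` is that of `w` with the two parts merged
  have key (w : Fin s → Option ι) (j : ι) : wordContent (fun k => (w k).getD i) j =
      wordContent w (some j) + if j = i then wordContent w none else 0 := by
    unfold wordContent
    split_ifs with h
    · subst h
      rw [← Finset.card_union_of_disjoint]
      · congr 1
        ext k
        cases hk : w k <;> simp [hk]
      · rw [Finset.disjoint_filter]
        intro k _ h1 h2
        simp [h1] at h2
    · rw [add_zero]
      congr 1
      ext k
      cases hk : w k <;> simp [hk, Ne.symm h]
  split_ifs with hv
  · have hci : (Finset.univ.filter fun k => v k = i).card = c i := congrFun hv i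
    rw [← hci, ← Finset.card_powersetCard]
    refine Finset.card_bij' (fun w _ => Finset.univ.filter fun k => w k = none)
      (fun A _ => fun k => if k ∈ A then none else some (v k)) ?_ ?_ ?_ ?_
    · intro w hw
      simp only [Finset.mem_filter, Finset.mem_univ, true_and] at hw
      rw [Finset.mem_powersetCard]
      refine ⟨fun k hk => ?_, congrFun hw.1 none⟩
      have hk' : w k = none := by simpa using hk
      simp [← hw.2, hk']
    · intro A hA
      rw [Finset.mem_powersetCard] at hA
      simp only [Finset.mem_filter, Finset.mem_univ, true_and]
      have h2 : (fun k => (if k ∈ A then none else some (v k)).getD i) = v := by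
        funext k
        split_ifs with hk
        · simpa [eq_comm] using hA.1 hk
        · rfl
      have hn : wordContent (fun k => if k ∈ A then none else some (v k)) none = b := by
        simp [wordContent, hA.2]
      refine ⟨?_, h2⟩
      funext j
      cases j with
      | none => exact hn
      | some j =>
        have := key (fun k => if k ∈ A then none else some (v k)) j
        rw [h2, hv, hn] at this
        simp only [splitContent]
        split_ifs at this ⊢ with hj
        · subst hj; omega
        · omega
    · intro w hw
      simp only [Finset.mem_filter, Finset.mem_univ, true_and] at hw
      funext k
      cases hk : w k with
      | none => simp [hk]
      | some j => simp [hk, ← hw.2]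
    · intro A _
      ext k
      simp
  · rw [Finset.card_eq_zero, Finset.filter_eq_empty_iff]
    rintro w - ⟨h1, h2⟩
    apply hv
    funext j
    rw [← h2, key, h1]
    simp only [splitContent]
    split_ifs with hj
    · subst hj; omega
    · omega

/-- Splitting the index `i` into two copies with multiplicities `c i - b` and `b` multiplies the part
of weight `c` by a binomial coefficient. -/
theorem weightTensor_split (f : ι → M →ₗ[R] N) (c : ι → ℕ) (i : ι) (b : ℕ)
    (hb : b ≤ c i) :
    weightTensor s (fun j : Option ι => f (j.getD i)) (splitContent c i b) =
      ((c i).choose b : R) • weightTensor s f c := by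
  unfold weightTensor
  rw [← Finset.sum_fiberwise _ (fun w : Fin s → Option ι => fun k => (w k).getD i)]
  simp only [Finset.filter_filter]
  rw [Finset.smul_sum, Finset.sum_filter]
  refine Finset.sum_congr rfl fun v _ => ?_
  trans (((if wordContent v = c then (c i).choose b else 0 : ℕ) : R)) •
    PiTensorProduct.map (fun k => f (v k))
  · rw [← card_wordContent_split c i b hb v, Nat.cast_smul_eq_nsmul, ← Finset.sum_const]
    refine Finset.sum_congr rfl fun w hw => ?_
    rw [← (Finset.mem_filter.mp hw).2.2]
  · split_ifs <;> simp

end WeightTensors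

section WeightMaps

variable {ι : Type} [DecidableEq ι] [Fintype ι] {s : ℕ} {R : Type u} [CommRing R]
  {M N P : FGProj R}

/-- `weightTensor` as a morphism of the Schur category. -/
def weightMap (s : ℕ) (f : ι → (M.obj →ₗ[R] N.obj)) (c : ι → ℕ) :
    (gammaFunctor R s).obj M ⟶ (gammaFunctor R s).obj N :=
  ⟨weightTensor s f c, weightTensor_mem f c⟩

theorem sum_weightMap (f : ι → (M.obj →ₗ[R] N.obj)) :
    ∑ c ∈ Finset.piAntidiag Finset.univ s, weightMap s f c =
      (gammaFunctor R s).map (FGProj.ofHom (∑ i, f i)) :=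
  Subtype.ext ((map_sum (equivariantMaps R s M.obj N.obj).subtype _ _).trans (sum_weightTensor f))

theorem weightMap_comp_map (f : ι → (M.obj →ₗ[R] N.obj)) (c : ι → ℕ) (g : N.obj →ₗ[R] P.obj) :
    weightMap s f c ≫ (gammaFunctor R s).map (FGProj.ofHom g) =
      weightMap s (fun i => g ∘ₗ f i) c :=
  Subtype.ext (map_comp_weightTensor g f c)

theorem map_comp_weightMap (g : M.obj →ₗ[R] N.obj) (f : ι → (N.obj →ₗ[R] P.obj)) (c : ι → ℕ) :
    (gammaFunctor R s).map (FGProj.ofHom g) ≫ weightMap s f c =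
      weightMap s (fun i => f i ∘ₗ g) c :=
  Subtype.ext (weightTensor_comp_map f c g)

theorem weightMap_congr {f g : ι → (M.obj →ₗ[R] N.obj)} {c : ι → ℕ}
    (h : ∀ i, 0 < c i → f i = g i) : weightMap s f c = weightMap s g c :=
  Subtype.ext (weightTensor_congr h)

theorem weightMap_eq_zero {f : ι → (M.obj →ₗ[R] N.obj)} {c : ι → ℕ} {i : ι}
    (hi : 0 < c i) (hf : f i = 0) : weightMap s f c = 0 :=
  Subtype.ext (weightTensor_eq_zero hi hf)

theorem weightMap_const (f : M.obj →ₗ[R] N.obj) (c : ι → ℕ) (hc : ∑ i, c i = s) :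
    weightMap s (fun _ : ι => f) c =
      (Nat.multinomial Finset.univ c : R) • (gammaFunctor R s).map (FGProj.ofHom f) :=
  Subtype.ext (weightTensor_const f c hc)

theorem weightMap_split (f : ι → (M.obj →ₗ[R] N.obj)) (c : ι → ℕ) (i : ι) (b : ℕ)
    (hb : b ≤ c i) :
    weightMap s (fun j : Option ι => f (j.getD i)) (splitContent c i b) =
      ((c i).choose b : R) • weightMap s f c :=
  Subtype.ext (weightTensor_split f c i b hb)

end WeightMaps

/-! ### Sums of powers of a prime -/

section PowersOfPrime

variable {p : ℕ}

theorem digitSum_le (p n : ℕ) : digitSum p n ≤ n := Nat.digit_sum_le p n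

/-- A positive integer `m` is a power of `p` if `p` divides all inner binomial coefficients of `m`: if
`m = p ^ k * u` with `p ∤ u`, then `m.choose (p ^ k)` is congruent to `u` modulo `p` by the theorem
of Lucas. -/
theorem exists_eq_pow_of_dvd_choose (hp : p.Prime) {m : ℕ} (hm : 0 < m)
    (h : ∀ b, 0 < b → b < m → p ∣ m.choose b) : ∃ k, m = p ^ k := by
  have := Fact.mk hp
  obtain ⟨k, u, hu, rfl⟩ := Nat.exists_eq_pow_mul_and_not_dvd hm.ne' p hp.ne_one
  refine ⟨k, ?_⟩
  have hpk : 0 < p ^ k := pow_pos hp.pos k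
  by_contra hne
  have hu1 : 1 < u := by
    rcases u with _ | _ | u
    · simp at hm
    · simp at hne
    · omega
  have hdvd := h (p ^ k) hpk (lt_mul_of_one_lt_right hpk hu1)
  have hmod := Choose.choose_modEq_choose_mul_prod_range_choose (p := p) (n := p ^ k * u)
    (k := p ^ k) k
  -- below the position `k` all digits of `p ^ k` vanish
  have hprod : ∏ i ∈ Finset.range k,
      (p ^ k * u / p ^ i % p).choose (p ^ k / p ^ i % p) = 1 := by
    refine Finset.prod_eq_one fun i hi => ?_
    have hi' := Finset.mem_range.mp hi
    have : p ^ k / p ^ i % p = 0 := by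
      rw [Nat.pow_div hi'.le hp.pos]
      exact Nat.mod_eq_zero_of_dvd (dvd_pow_self p (by omega))
    rw [this, Nat.choose_zero_right]
  rw [Nat.mul_div_cancel_left u hpk, Nat.div_self hpk, Nat.choose_one_right, hprod, Nat.cast_one,
    mul_one] at hmod
  have := (Int.natCast_modEq_iff.mp hmod).dvd_iff (dvd_refl p)
  exact hu (this.mp hdvd)

/-- Legendre's formula for the multinomial coefficient of a family of powers of `p`. -/
theorem card_eq_digitSum_add (hp : p.Prime) {ι : Type} [Fintype ι] (k : ι → ℕ) {s : ℕ}
    (hs : ∑ i, p ^ k i = s) :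
    Fintype.card ι = digitSum p s +
      (p - 1) * padicValNat p (Nat.multinomial Finset.univ fun i => p ^ k i) := by
  have := Fact.mk hp
  have h1 := Nat.multinomial_spec Finset.univ (fun i => p ^ k i)
  have h2 := congrArg (fun n => (p - 1) * padicValNat p n) h1
  have hprod : padicValNat p (∏ i, (p ^ k i).factorial) =
      ∑ i, padicValNat p (p ^ k i).factorial := by
    simp only [← Nat.factorization_def _ hp]
    exact Nat.factorization_prod_apply fun i _ => Nat.factorial_ne_zero _
  rw [padicValNat.mul (Finset.prod_ne_zero_iff.mpr fun i _ => Nat.factorial_ne_zero _)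
    (Nat.multinomial_pos _ _).ne', hprod, hs, sub_one_mul_padicValNat_factorial, mul_add,
    Finset.mul_sum] at h2
  have h3 (i : ι) : (p - 1) * padicValNat p (p ^ k i).factorial + 1 = p ^ k i := by
    rw [sub_one_mul_padicValNat_factorial]
    have : (p.digits (p ^ k i)).sum = 1 := by
      rw [← mul_one (p ^ k i), Nat.digits_base_pow_mul hp.one_lt one_pos]
      simp [Nat.digits_of_lt p 1 one_ne_zero hp.one_lt]
    rw [this]
    exact Nat.sub_add_cancel (Nat.one_le_pow _ _ hp.pos)
  have h4 : ∑ i, (p - 1) * padicValNat p (p ^ k i).factorial + Fintype.card ι = s := by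
    rw [← hs, ← Finset.sum_congr rfl fun i _ => h3 i, Finset.sum_add_distrib]
    simp
  have h5 := digitSum_le p s
  unfold digitSum at *
  omega

/-- An integer `s` is a sum of `digitSum p s + (p - 1) * r` powers of `p`, as long as this number is
at most `s`: start from the `p`-adic expansion, and keep replacing some `p ^ (k + 1)` by `p` copies
of `p ^ k`. -/
theorem exists_sum_pow_eq (hp : p.Prime) (s r : ℕ) (h : digitSum p s + (p - 1) * r ≤ s) :
    ∃ m : Multiset ℕ, m.card = digitSum p s + (p - 1) * r ∧ (m.map (p ^ ·)).sum = s := by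
  induction r with
  | zero =>
    clear h
    induction s using Nat.strong_induction_on with
    | _ s ih =>
      rcases Nat.eq_zero_or_pos s with rfl | hs
      · exact ⟨0, by simp [digitSum]⟩
      · obtain ⟨m, hm1, hm2⟩ := ih (s / p) (Nat.div_lt_self hs hp.one_lt)
        refine ⟨Multiset.replicate (s % p) 0 + m.map (· + 1), ?_, ?_⟩
        · simp only [digitSum] at hm1 ⊢
          rw [Nat.digits_def' hp.one_lt hs]
          simp [hm1]
        · simp only [Multiset.map_add, Multiset.sum_add, Multiset.map_map, Function.comp_def,
            pow_succ', Multiset.sum_map_mul_left, hm2]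
          simp [Nat.mod_add_div]
  | succ r ih =>
    have hp1 := hp.one_lt
    rw [mul_add, mul_one] at h
    obtain ⟨m, hm1, hm2⟩ := ih (by omega)
    -- if all exponents were zero, `s` would equal the number of summands, which is less than `s`
    obtain ⟨k, hk, hk0⟩ : ∃ k ∈ m, k ≠ 0 := by
      by_contra! hall
      rw [Multiset.eq_replicate_card.mpr hall] at hm2
      simp at hm2
      omega
    obtain ⟨k, rfl⟩ := Nat.exists_eq_succ_of_ne_zero hk0
    obtain ⟨m, rfl⟩ := Multiset.exists_cons_of_mem hk
    refine ⟨Multiset.replicate p k + m, ?_, ?_⟩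
    · simp at hm1 ⊢
      rw [mul_add]
      omega
    · simp [pow_succ'] at hm2 ⊢
      exact hm2

theorem exists_family_sum_pow_eq (hp : p.Prime) (s r : ℕ) (h : digitSum p s + (p - 1) * r ≤ s) :
    ∃ k : Fin (digitSum p s + (p - 1) * r) → ℕ, ∑ i, p ^ k i = s := by
  obtain ⟨m, hm1, hm2⟩ := exists_sum_pow_eq hp s r h
  obtain ⟨l, rfl⟩ := Quot.exists_rep m
  change l.length = _ at hm1
  rw [← hm1]
  refine ⟨l.get, ?_⟩
  simpa using hm2

end PowersOfPrime

/-! ### Weight decomposition and cross effects -/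

section CrossEffects

variable {R : Type u} [CommRing R] {s : ℕ} (F : StrictPolyFunctor.{u, w} R s)

namespace FGProj

/-- The inclusion of the `i`-th summand of a direct sum. -/
def single {n : ℕ} (X : Fin n → FGProj R) (i : Fin n) : (X i).obj →ₗ[R] (directSum X).obj :=
  LinearMap.single R (fun j => (X j).obj) i

/-- The projection of a direct sum onto its `i`-th summand. -/
def proj {n : ℕ} (X : Fin n → FGProj R) (i : Fin n) : (directSum X).obj →ₗ[R] (X i).obj :=
  LinearMap.proj (R := R) (φ := fun j => (X j).obj) i

theorem sum_single_comp_proj {n : ℕ} (X : Fin n → FGProj R) :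
    ∑ i, single X i ∘ₗ proj X i = LinearMap.id := by
  refine LinearMap.ext fun x => ?_
  rw [LinearMap.sum_apply]
  exact LinearMap.sum_single_apply (φ := fun j => (X j).obj) x

theorem sum_proj_comp_single {n : ℕ} (N : FGProj R) (i : Fin n) :
    (∑ j, (proj (fun _ : Fin n => N) j : (directSum fun _ : Fin n => N).obj →ₗ[R] N.obj)) ∘ₗ
      single (fun _ => N) i = LinearMap.id := by
  refine LinearMap.ext fun x => ?_
  rw [LinearMap.comp_apply, LinearMap.sum_apply]
  exact (Fintype.sum_eq_single i fun j hj => Pi.single_eq_of_ne (M := fun _ => N.obj) hj x).trans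
    (Pi.single_eq_same (M := fun _ => N.obj) i x)

theorem forgetSummand_comp_single {n : ℕ} (X : Fin n → FGProj R) (i : Fin n) :
    linearMap (forgetSummand X i) ∘ₗ single X i = 0 := by
  refine LinearMap.ext fun x => funext fun j => ?_
  exact Pi.single_eq_of_ne (M := fun j => (X j).obj) j.2 x

/-- The section of `forgetSummand X i` whose `i`-th component is zero. -/
def extendByZero {n : ℕ} (X : Fin n → FGProj R) (i : Fin n) :
    (directSum fun j : {j : Fin n // j ≠ i} => X j).obj →ₗ[R] (directSum X).obj :=
  LinearMap.pi (φ := fun j => (X j).obj) fun j =>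
    if h : j ≠ i then
      LinearMap.proj (R := R) (φ := fun k : {k : Fin n // k ≠ i} => (X k).obj) ⟨j, h⟩ else 0

theorem proj_comp_extendByZero {n : ℕ} (X : Fin n → FGProj R) {i j : Fin n} (h : j ≠ i) :
    proj X j ∘ₗ extendByZero X i =
      LinearMap.proj (R := R) (φ := fun k : {k : Fin n // k ≠ i} => (X k).obj) ⟨j, h⟩ :=
  (LinearMap.proj_pi (φ := fun j => (X j).obj) _ j).trans (dif_pos h)

theorem proj_comp_extendByZero_comp_forgetSummand {n : ℕ} (X : Fin n → FGProj R) {i j : Fin n}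
    (h : j ≠ i) : (proj X j ∘ₗ extendByZero X i) ∘ₗ linearMap (forgetSummand X i) = proj X j := by
  rw [proj_comp_extendByZero X h]
  rfl

end FGProj

namespace StrictPolyFunctor

instance : F.functor.Additive := F.additive

instance : F.functor.Linear R := F.linear

variable {ι : Type} [DecidableEq ι] [Fintype ι] {M N P : FGProj R}

/-- The action on the values of `F` of the part of weight `c` of `(∑ i, f i)^{⊗ s}`. -/
def weightAct (f : ι → (M.obj →ₗ[R] N.obj)) (c : ι → ℕ) :
    F.underlying.obj M →ₗ[R] F.underlying.obj N :=
  (F.functor.map (weightMap s f c)).hom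

theorem sum_weightAct (f : ι → (M.obj →ₗ[R] N.obj)) :
    ∑ c ∈ Finset.piAntidiag Finset.univ s, F.weightAct f c =
      (F.underlying.map (FGProj.ofHom (∑ i, f i))).hom := by
  have h := congrArg F.functor.map (sum_weightMap (s := s) f)
  rw [F.functor.map_sum] at h
  exact (ModuleCat.hom_sum _ _).symm.trans (congrArg ModuleCat.Hom.hom h)

theorem map_comp_weightAct (g : N.obj →ₗ[R] P.obj) (f : ι → (M.obj →ₗ[R] N.obj)) (c : ι → ℕ) :
    (F.underlying.map (FGProj.ofHom g)).hom ∘ₗ F.weightAct f c =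
      F.weightAct (fun i => g ∘ₗ f i) c :=
  congrArg ModuleCat.Hom.hom ((F.functor.map_comp _ _).symm.trans
    (congrArg F.functor.map (weightMap_comp_map f c g)))

theorem weightAct_comp_map (f : ι → (N.obj →ₗ[R] P.obj)) (c : ι → ℕ) (g : M.obj →ₗ[R] N.obj) :
    F.weightAct f c ∘ₗ (F.underlying.map (FGProj.ofHom g)).hom =
      F.weightAct (fun i => f i ∘ₗ g) c :=
  congrArg ModuleCat.Hom.hom ((F.functor.map_comp _ _).symm.trans
    (congrArg F.functor.map (map_comp_weightMap g f c)))

theorem weightAct_congr {f g : ι → (M.obj →ₗ[R] N.obj)} {c : ι → ℕ}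
    (h : ∀ i, 0 < c i → f i = g i) : F.weightAct f c = F.weightAct g c := by
  rw [weightAct, weightAct, weightMap_congr h]

theorem weightAct_eq_zero {f : ι → (M.obj →ₗ[R] N.obj)} {c : ι → ℕ} {i : ι}
    (hi : 0 < c i) (hf : f i = 0) : F.weightAct f c = 0 := by
  rw [weightAct, weightMap_eq_zero hi hf, F.functor.map_zero]
  rfl

theorem map_ofHom_id (M : FGProj R) :
    (F.underlying.map (FGProj.ofHom (LinearMap.id : M.obj →ₗ[R] M.obj))).hom = LinearMap.id :=
  congrArg ModuleCat.Hom.hom (F.underlying.map_id M)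

theorem weightAct_id (c : ι → ℕ) (hc : ∑ i, c i = s) (x : F.underlying.obj M) :
    F.weightAct (fun _ : ι => (LinearMap.id : M.obj →ₗ[R] M.obj)) c x =
      Nat.multinomial Finset.univ c • x := by
  rw [weightAct, weightMap_const _ c hc, F.functor.map_smul, ← Nat.cast_smul_eq_nsmul R]
  exact congrArg _ (LinearMap.congr_fun (F.map_ofHom_id M) x)

theorem weightAct_split (f : ι → (M.obj →ₗ[R] N.obj)) (c : ι → ℕ) (i : ι) (b : ℕ)
    (hb : b ≤ c i) (x : F.underlying.obj M) :
    F.weightAct (fun j : Option ι => f (j.getD i)) (splitContent c i b) x =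
      (c i).choose b • F.weightAct f c x := by
  rw [weightAct, weightMap_split f c i b hb, F.functor.map_smul, ← Nat.cast_smul_eq_nsmul R]
  rfl

/-- A functor of degree at most `d` kills `weightMap s f c` if more than `d` multiplicities are
positive. Grouping the indices by `q`, this map factors through `N^{d+1}` in such a way that the
image under `F` of the first factor lies in the cross effect. -/
theorem weightAct_eq_zero_of_isPolynomialOfDegreeLE {d : ℕ}
    (hd : IsPolynomialOfDegreeLE F.underlying d)
    (f : ι → (M.obj →ₗ[R] N.obj)) (c : ι → ℕ) (hc : ∀ i, 0 < c i) (q : ι → Fin (d + 1))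
    (hq : Function.Surjective q) : F.weightAct f c = 0 := by
  let X : Fin (d + 1) → FGProj R := fun _ => N
  let f' : ι → (M.obj →ₗ[R] (FGProj.directSum X).obj) := fun i => FGProj.single X (q i) ∘ₗ f i
  -- forgetting the summand `q i` kills the component `f' i`, which is used `c i > 0` times
  have hcross (x : F.underlying.obj M) : F.weightAct f' c x = 0 := by
    rw [← Submodule.mem_bot (R := R), ← hd X]
    refine (Submodule.mem_iInf _).mpr fun j => ?_
    obtain ⟨i, rfl⟩ := hq j
    refine LinearMap.congr_fun ((F.map_comp_weightAct
      (FGProj.linearMap (FGProj.forgetSummand X (q i))) f' c).trans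
        (F.weightAct_eq_zero (hc i) ?_)) x
    rw [← LinearMap.comp_assoc, FGProj.forgetSummand_comp_single, LinearMap.zero_comp]
  have hfac : F.weightAct f c = (F.underlying.map (FGProj.ofHom
      (∑ j, (FGProj.proj X j : (FGProj.directSum X).obj →ₗ[R] N.obj)))).hom ∘ₗ
        F.weightAct f' c := by
    rw [map_comp_weightAct]
    refine F.weightAct_congr fun i _ => ?_
    rw [← LinearMap.comp_assoc, FGProj.sum_proj_comp_single N (q i), LinearMap.id_comp]
  ext x
  rw [hfac, LinearMap.comp_apply, hcross, map_zero, LinearMap.zero_apply]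

theorem multinomial_nsmul_eq_zero {d : ℕ} (hd : IsPolynomialOfDegreeLE F.underlying d)
    (c : ι → ℕ) (hc : ∀ i, 0 < c i) (hs : ∑ i, c i = s) (q : ι → Fin (d + 1))
    (hq : Function.Surjective q) (x : F.underlying.obj M) :
    Nat.multinomial Finset.univ c • x = 0 := by
  rw [← F.weightAct_id c hs, F.weightAct_eq_zero_of_isPolynomialOfDegreeLE hd _ c hc q hq,
    LinearMap.zero_apply]

theorem choose_nsmul_eq_zero {d : ℕ} (hd : IsPolynomialOfDegreeLE F.underlying d)
    (f : Fin d → (M.obj →ₗ[R] N.obj)) (c : Fin d → ℕ) (hc : ∀ i, 0 < c i) (i : Fin d) {b : ℕ}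
    (hb : 0 < b) (hbc : b < c i) (x : F.underlying.obj M) :
    (c i).choose b • F.weightAct f c x = 0 := by
  rw [← F.weightAct_split f c i b hbc.le,
    F.weightAct_eq_zero_of_isPolynomialOfDegreeLE hd _ _ ?_ (finSuccEquiv d).symm
      (finSuccEquiv d).symm.surjective, LinearMap.zero_apply]
  rintro (_ | j)
  · exact hb
  · simp only [splitContent]
    split_ifs
    · omega
    · exact hc j

/-- The projection of `F(X₁ ⊕ ⋯ ⊕ Xₙ)` onto its part of weight `c`. -/
def weightProjection {n : ℕ} (X : Fin n → FGProj R) (c : Fin n → ℕ) :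
    F.underlying.obj (FGProj.directSum X) →ₗ[R] F.underlying.obj (FGProj.directSum X) :=
  F.weightAct (fun j => FGProj.single X j ∘ₗ FGProj.proj X j) c

theorem weightProjection_apply_eq_zero {n : ℕ} (X : Fin n → FGProj R) {x}
    (hx : x ∈ crossEffect F.underlying X) (c : Fin n → ℕ) {i : Fin n} (hi : c i = 0) :
    F.weightProjection X c x = 0 := by
  have hfac : F.weightProjection X c = F.weightAct
      (fun j => (FGProj.single X j ∘ₗ FGProj.proj X j) ∘ₗ FGProj.extendByZero X i) c ∘ₗ
        (F.underlying.map (FGProj.forgetSummand X i)).hom := by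
    refine Eq.trans (F.weightAct_congr (g := fun j => ((FGProj.single X j ∘ₗ FGProj.proj X j) ∘ₗ
      FGProj.extendByZero X i) ∘ₗ FGProj.linearMap (FGProj.forgetSummand X i))
        fun j hj => ?_) (F.weightAct_comp_map _ c
      (FGProj.linearMap (FGProj.forgetSummand X i))).symm
    have hji : j ≠ i := fun h => by rw [h, hi] at hj; exact hj.false
    rw [LinearMap.comp_assoc (FGProj.extendByZero X i), LinearMap.comp_assoc,
      FGProj.proj_comp_extendByZero_comp_forgetSummand X hji]
  rw [hfac, LinearMap.comp_apply, LinearMap.mem_ker.mp ((Submodule.mem_iInf _).mp hx i), map_zero]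

/-- A nonzero element of the cross effect has a nonzero component in some weight all of whose
multiplicities are positive. -/
theorem exists_weightProjection_ne_zero {n : ℕ} (X : Fin n → FGProj R) {x}
    (hx : x ∈ crossEffect F.underlying X) (hx0 : x ≠ 0) :
    ∃ c : Fin n → ℕ, ∑ i, c i = s ∧ (∀ i, 0 < c i) ∧ F.weightProjection X c x ≠ 0 := by
  by_contra! hall
  apply hx0
  have h := LinearMap.congr_fun
    (F.sum_weightAct fun j => FGProj.single X j ∘ₗ FGProj.proj X j) x
  rw [FGProj.sum_single_comp_proj, map_ofHom_id, LinearMap.sum_apply, LinearMap.id_apply] at h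
  rw [← h]
  refine Finset.sum_eq_zero fun c hc => ?_
  by_cases hpos : ∀ i, 0 < c i
  · exact hall c (by simpa using hc) hpos
  · push Not at hpos
    obtain ⟨i, hi⟩ := hpos
    exact F.weightProjection_apply_eq_zero X hx c (Nat.le_zero.mp hi)

theorem isPolynomialOfDegreeLE_weight : IsPolynomialOfDegreeLE F.underlying s := by
  intro X
  rw [Submodule.eq_bot_iff]
  intro x hx
  by_contra hx0
  obtain ⟨c, hs, hpos, -⟩ := F.exists_weightProjection_ne_zero X hx hx0
  have := Finset.card_nsmul_le_sum Finset.univ c 1 fun i _ => hpos i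
  simp [hs] at this

theorem not_isPolynomialOfDegreeLE_zero (hF : F.IsNonzero) (hs : 0 < s) :
    ¬ IsPolynomialOfDegreeLE F.underlying 0 := by
  intro h
  obtain ⟨M, hM⟩ := hF
  obtain ⟨x, hx⟩ := exists_ne (0 : F.underlying.obj M)
  apply hx
  simpa using F.multinomial_nsmul_eq_zero h (fun _ : Fin 1 => s) (fun _ => hs) (by simp) id
    Function.surjective_id x

end StrictPolyFunctor

end CrossEffects

/-! ### Degree and torsion -/

section Degree

namespace StrictPolyFunctor

variable {R : Type u} [CommRing R] {s : ℕ} (F : StrictPolyFunctor.{u, w} R s) {p : ℕ}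

/-- If `d` is the degree of a nonzero `p`-primary functor of weight `s`, then `s` is a sum of `d`
powers of `p`, namely of the multiplicities of any nonzero weight space of the `d`-th cross effect. -/
theorem exists_sum_pow_eq_weight (hp : p.Prime) (hF : F.IsNonzero) (hprim : F.IsPrimary p) {d : ℕ}
    (hd : IsPolynomialOfDegreeLE F.underlying d)
    (hmin : ∀ m < d, ¬ IsPolynomialOfDegreeLE F.underlying m) :
    ∃ k : Fin d → ℕ, ∑ i, p ^ k i = s := by
  rcases d with _ | e
  · refine ⟨fun _ => 0, ?_⟩
    rcases Nat.eq_zero_or_pos s with rfl | hs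
    · simp
    · exact absurd hd (F.not_isPolynomialOfDegreeLE_zero hF hs)
  · have he := hmin e e.lt_succ_self
    simp only [IsPolynomialOfDegreeLE, not_forall] at he
    obtain ⟨X, hX⟩ := he
    obtain ⟨x, hx, hx0⟩ := Submodule.exists_mem_ne_zero_of_ne_bot hX
    obtain ⟨c, hs, hpos, hy0⟩ := F.exists_weightProjection_ne_zero X hx hx0
    -- a suitable multiple `p ^ r` of the component in weight `c` has order exactly `p`
    obtain ⟨r, hr, hrmin⟩ : ∃ r, p ^ (r + 1) • F.weightProjection X c x = 0 ∧
        p ^ r • F.weightProjection X c x ≠ 0 := by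
      classical
      have hex := hprim _ (F.weightProjection X c x)
      have h0 : Nat.find hex ≠ 0 := by
        intro h
        have := Nat.find_spec hex
        rw [h, pow_zero, one_smul] at this
        exact hy0 this
      refine ⟨Nat.find hex - 1, ?_, Nat.find_min hex (by omega)⟩
      rw [Nat.sub_add_cancel (by omega)]
      exact Nat.find_spec hex
    rw [pow_succ', mul_smul] at hr
    rw [← map_nsmul] at hr hrmin
    have hpow (i : Fin (e + 1)) : ∃ k, c i = p ^ k := by
      refine exists_eq_pow_of_dvd_choose hp (hpos i) fun b hb hbc => ?_
      by_contra hndvd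
      refine hrmin (AddMonoid.addOrderOf_eq_one_iff.mp (Nat.eq_one_of_dvd_coprimes
        ((Nat.Prime.coprime_iff_not_dvd hp).mpr hndvd)
        (addOrderOf_dvd_of_nsmul_eq_zero hr) (addOrderOf_dvd_of_nsmul_eq_zero ?_)))
      exact F.choose_nsmul_eq_zero hd _ c hpos i hb hbc _
    choose k hk using hpow
    exact ⟨k, by rw [← hs]; exact Finset.sum_congr rfl fun i _ => (hk i).symm⟩

/-- If `F` has degree at most `d`, and `s` is a sum of `n > d` powers of `p`, then the multinomial
coefficient of these powers, of `p`-adic valuation `r`, kills `F`; its part prime to `p` acts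
invertibly on a `p`-primary functor. -/
theorem torsionBoundedBy_of_sum_pow_eq (hp : p.Prime) (hprim : F.IsPrimary p) {d n r : ℕ}
    (hd : IsPolynomialOfDegreeLE F.underlying d) (hdn : d < n)
    (hn : n = digitSum p s + (p - 1) * r) (k : Fin n → ℕ) (hk : ∑ i, p ^ k i = s) :
    F.TorsionBoundedBy (p ^ r) := by
  intro M x
  have := Fact.mk hp
  have hval := card_eq_digitSum_add hp k hk
  rw [Fintype.card_fin] at hval
  replace hval := Nat.eq_of_mul_eq_mul_left (Nat.sub_pos_of_lt hp.one_lt)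
    (Nat.add_left_cancel (hn.symm.trans hval))
  -- the `n` indices are grouped into `d + 1` nonempty classes, the last one taking the surplus
  have hkill := F.multinomial_nsmul_eq_zero hd (fun i => p ^ k i) (fun i => pow_pos hp.pos _) hk
    (fun i => ⟨min i d, by omega⟩)
    (fun j => ⟨⟨j, by omega⟩, Fin.ext (min_eq_left (by simpa using Nat.le_of_lt_succ j.2))⟩) x
  obtain ⟨m, hm⟩ := hprim M x
  obtain ⟨j, -, hj⟩ := (Nat.dvd_prime_pow hp).mp (addOrderOf_dvd_of_nsmul_eq_zero hm)
  have hdvd := addOrderOf_dvd_of_nsmul_eq_zero hkill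
  rw [hj, padicValNat_dvd_iff_le (Nat.multinomial_pos _ _).ne', ← hval] at hdvd
  exact addOrderOf_dvd_iff_nsmul_eq_zero.mp (hj ▸ pow_dvd_pow p hdvd)

end StrictPolyFunctor

open Classical in
theorem emlDegree_eq_find {R : Type u} [CommRing R] {F : FGProj R ⥤ ModuleCat.{w} R}
    (hF : ∃ M : FGProj R, Nontrivial (F.obj M)) (h : ∃ d, IsPolynomialOfDegreeLE F d) :
    emlDegree F = ((Nat.find h : ℕ) : WithBot ℕ∞) := by
  have hne : ¬ ∀ M : FGProj R, Subsingleton (F.obj M) := by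
    obtain ⟨M, hM⟩ := hF
    exact fun hall => not_subsingleton _ (hall M)
  rw [emlDegree, if_neg hne]
  have : (⨅ (d : ℕ) (_ : IsPolynomialOfDegreeLE F d), (d : ℕ∞)) = (Nat.find h : ℕ∞) :=
    le_antisymm (iInf₂_le _ (Nat.find_spec h))
      (le_iInf₂ fun m hm => Nat.cast_le.mpr (Nat.find_min' h hm))
  rw [this]
  rfl

end Degree

theorem theorem1p2 {R : Type u} [CommRing R] (p s : ℕ) (hp : p.Prime)
    (F : StrictPolyFunctor.{u, w} R s) (hF : F.IsNonzero) (hprim : F.IsPrimary p) :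
    ∃ d : ℕ, emlDegree F.underlying = (d : WithBot ℕ∞) ∧
      d ∈ digitInterval p s ∧
      (d < s → F.TorsionBoundedBy
        (p ^ ⌈((d : ℚ) + 1 - (digitSum p s : ℚ)) / ((p : ℚ) - 1)⌉₊)) := by
  classical
  have hex : ∃ d, IsPolynomialOfDegreeLE F.underlying d := ⟨s, F.isPolynomialOfDegreeLE_weight⟩
  refine ⟨Nat.find hex, emlDegree_eq_find hF hex, ?_⟩
  have hd := Nat.find_spec hex
  have hds : Nat.find hex ≤ s := Nat.find_min' hex F.isPolynomialOfDegreeLE_weight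
  obtain ⟨k, hk⟩ := F.exists_sum_pow_eq_weight hp hF hprim hd fun m hm => Nat.find_min hex hm
  have hdeg := card_eq_digitSum_add hp k hk
  -- `s` itself is a sum of `s` powers of `p`, all equal to `1`
  have hweight := card_eq_digitSum_add hp (fun _ : Fin s => 0) (s := s) (by simp)
  rw [Fintype.card_fin] at hdeg hweight
  generalize Nat.find hex = d at *
  generalize padicValNat p _ = v at hdeg
  generalize padicValNat p _ = V at hweight
  have hp1 : 0 < p - 1 := Nat.sub_pos_of_lt hp.one_lt
  refine ⟨⟨?_, by omega, hds⟩, fun hlt => ?_⟩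
  · have h1 := congrArg (· % (p - 1)) hdeg
    have h2 := congrArg (· % (p - 1)) hweight
    simp only [Nat.add_mul_mod_self_left] at h1 h2
    exact h1.trans h2.symm
  · have hvV : v + 1 ≤ V := by
      by_contra! hV
      have := Nat.mul_le_mul_left (p - 1) (Nat.le_of_lt_succ hV)
      omega
    have hceil : ⌈((d : ℚ) + 1 - (digitSum p s : ℚ)) / ((p : ℚ) - 1)⌉₊ = v + 1 := by
      have hcast : ((p : ℚ) - 1) = ((p - 1 : ℕ) : ℚ) := by
        rw [Nat.cast_sub hp.one_lt.le, Nat.cast_one]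
      have h1 : (1 : ℚ) ≤ ((p - 1 : ℕ) : ℚ) := by exact_mod_cast hp1
      rw [Nat.ceil_eq_iff (by omega), hcast, lt_div_iff₀ (by linarith), div_le_iff₀ (by linarith),
        hdeg]
      push_cast
      constructor <;> nlinarith
    have hle : digitSum p s + (p - 1) * (v + 1) ≤ s := by
      have := Nat.mul_le_mul_left (p - 1) hvV
      omega
    obtain ⟨l, hl⟩ := exists_family_sum_pow_eq hp s (v + 1) hle
    rw [hceil]
    refine F.torsionBoundedBy_of_sum_pow_eq hp hprim hd ?_ rfl l hl
    rw [mul_add]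
    omega
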